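/- For a finite simple graph $G$ without isolated edges, let $d_v$ denote the degree of the vertex $v$ and let $$ASO(G)=\sum_{uv\in E(G)}\sqrt{\frac{d_u^2+d_v^2}{d_u+d_v-2}}$$ be its augmented Sombor index. The edge connectivity of a connected graph with at least two vertices is the minimum number of edges whose deletion disconnects it. Let $G\cup H$ be the disjoint union of two graphs and let $G\vee H$ be their join, that is, the disjoint union together with all edges between the vertices of $G$ and the vertices of $H$. **Theorem.** Let $G$ be a connected (finite, simple) graph of order $n\ge 4$ with edge connectivity $k'$. Then $$ASO(G)\le k'\sqrt{\frac{(n-1)^2+k'^2}{n+k'-3}}+\binom{k'}{2}\sqrt{n+\frac{1}{n-2}}+k'(n-k'-1)\sqrt{n-\frac12+\frac{5}{2(2n-5)}}+\binom{n-k'-1}{2}\sqrt{n-1+\frac{1}{n-3}}.$$ If $k'\le n-2$, equality holds if and only if $G\cong (K_1\cup K_{n-k'-1})\vee K_{k'}$; if $k'=n-1$, equality holds if and only if $G\cong K_n$. -/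

import Mathlib

namespace SimpleGraph

/-- The augmented Sombor index of a finite simple graph: the sum over all edges `v w` of
`√((d(v)² + d(w)²) / (d(v) + d(w) - 2))`, where `d` is the degree. The denominator is computed
in `ℝ`; it is positive on every edge of a graph that has no isolated edge, in particular on every
edge of a connected graph with at least three vertices. -/
noncomputable def augmentedSombor {V : Type*} [Fintype V] [DecidableEq V]
    (G : SimpleGraph V) [DecidableRel G.Adj] : ℝ :=
  ∑ e ∈ G.edgeFinset,
    Sym2.lift ⟨fun v w =>
      Real.sqrt (((G.degree v : ℝ) ^ 2 + (G.degree w : ℝ) ^ 2) /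
        ((G.degree v : ℝ) + (G.degree w : ℝ) - 2)),
      fun v w => by simp only [add_comm]⟩ e

/-- The edge connectivity of a graph: the least number of edges whose deletion leaves a
disconnected graph. (For a finite graph with at least two vertices such a set of edges exists.) -/
noncomputable def edgeConnectivity {V : Type*} (G : SimpleGraph V) : ℕ :=
  sInf {m : ℕ | ∃ s : Finset (Sym2 V),
    (s : Set (Sym2 V)) ⊆ G.edgeSet ∧ s.card = m ∧ ¬ (G.deleteEdges (s : Set (Sym2 V))).Connected}

/-- The join of two vertex-disjoint graphs: their disjoint union together with all edges between
the two vertex sets. -/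
def join {V W : Type*} (G : SimpleGraph V) (H : SimpleGraph W) : SimpleGraph (V ⊕ W) :=
  (G ⊕g H) ⊔ completeBipartiteGraph V W

end SimpleGraph

/-- The graph `(K₁ ∪ K_{n-k-1}) ∨ K_k`; it has `n` vertices when `k + 1 ≤ n`. -/
def extremalGraph (n k : ℕ) : SimpleGraph ((Fin 1 ⊕ Fin (n - k - 1)) ⊕ Fin k) :=
  (SimpleGraph.completeGraph (Fin 1) ⊕g SimpleGraph.completeGraph (Fin (n - k - 1))).join (SimpleGraph.completeGraph (Fin k))

/-- The explicit upper bound, as a function of the order `n` and the connectivity `k`. It is used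
for `n ≥ 4` and `k ≤ n - 1` only, so that the subtraction of natural numbers in the last binomial
coefficient is not truncated. -/
noncomputable def asoBound (n k : ℕ) : ℝ :=
  (k : ℝ) * Real.sqrt ((((n : ℝ) - 1) ^ 2 + (k : ℝ) ^ 2) / ((n : ℝ) + k - 3))
    + (k.choose 2 : ℝ) * Real.sqrt ((n : ℝ) + 1 / ((n : ℝ) - 2))
    + (k : ℝ) * ((n : ℝ) - k - 1) *
        Real.sqrt ((n : ℝ) - 1 / 2 + 5 / (2 * (2 * (n : ℝ) - 5)))
    + ((n - k - 1).choose 2 : ℝ) * Real.sqrt ((n : ℝ) - 1 + 1 / ((n : ℝ) - 3))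

open Finset

/-! The index strictly increases when an edge `uv` is added to a connected graph on at least three
vertices. Only edges at `u` or `v` can lose weight, each at `u` at most `1 / (2√d_u)`, so the total
loss is at most `√d_u / 2 + √d_v / 2`, and the weight of the new edge exceeds this
(`somborWeight_sub_le`, `half_sqrt_add_half_sqrt_lt_somborWeight`).

Every degree is at least `k'`. If some `v` has degree exactly `k'`, then `G` lies in the complete
graph with all but those `k'` edges at `v` removed. That graph is the extremal one, and monotonicity
gives the bound with its equality case.

Otherwise all degrees exceed `k'`. Then both sides of a minimum cut have at least `k' + 2` vertices,
which forces degrees at most `n - 3`, weights at most `√(n - 1)` and fewer than `(n-1).choose 2`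
edges. The bound is at least `(n-1).choose 2` times `√(n - 1)`, so the inequality is strict. -/

/-! ### Estimates for the weight of an edge -/

/-- The contribution to the augmented Sombor index of an edge whose ends have degrees
`x` and `y`. -/
noncomputable def somborWeight (x y : ℕ) : ℝ :=
  √(((x : ℝ) ^ 2 + (y : ℝ) ^ 2) / ((x : ℝ) + (y : ℝ) - 2))

theorem somborWeight_comm (x y : ℕ) : somborWeight x y = somborWeight y x := by
  simp only [somborWeight, add_comm]

theorem somborWeight_sq {x y : ℕ} (h : 3 ≤ x + y) :
    somborWeight x y ^ 2 = ((x : ℝ) ^ 2 + (y : ℝ) ^ 2) / ((x : ℝ) + (y : ℝ) - 2) := by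
  have : (3 : ℝ) ≤ x + y := mod_cast h
  exact Real.sq_sqrt (div_nonneg (by positivity) (by linarith))

theorem sqrt_le_somborWeight {x y : ℕ} (h : 3 ≤ x + y) {c : ℝ}
    (hc : 2 * c ≤ x + y) : √c ≤ somborWeight x y := by
  have : (3 : ℝ) ≤ x + y := mod_cast h
  refine Real.sqrt_le_sqrt ?_
  rw [le_div_iff₀ (by linarith)]
  nlinarith [sq_nonneg ((x : ℝ) - y),
    mul_le_mul_of_nonneg_right hc (by linarith : (0:ℝ) ≤ x + y - 2)]

/-- Raising one of the two degrees by one lowers the weight of an edge by little. -/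
theorem somborWeight_sub_le {x y : ℕ} (hx : 1 ≤ x) (hy : 1 ≤ y) (h : 3 ≤ x + y) :
    somborWeight x y - somborWeight (x + 1) y ≤ 1 / (2 * √x) := by
  have hX : (1 : ℝ) ≤ x := mod_cast hx
  have hY : (1 : ℝ) ≤ y := mod_cast hy
  have hXY : (3 : ℝ) ≤ x + y := mod_cast h
  have hs : 0 < √(x : ℝ) := Real.sqrt_pos.2 (by linarith)
  have hpos : 0 ≤ 1 / (2 * √(x : ℝ)) := by positivity
  rcases lt_or_ge y x with hyx | hxy
  · have hYX : (y : ℝ) + 1 ≤ x := mod_cast hyx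
    suffices somborWeight x y ≤ somborWeight (x + 1) y by linarith
    refine Real.sqrt_le_sqrt ?_
    push_cast
    rw [div_le_div_iff₀ (by linarith) (by linarith)]
    nlinarith
  -- Both weights are at least `√x` and their squares differ by at most 1; dividing by their sum
  -- gives the claim.
  · have hXY' : (x : ℝ) ≤ y := mod_cast hxy
    have ha : √(x : ℝ) ≤ somborWeight x y := sqrt_le_somborWeight h (by linarith)
    have hb : √(x : ℝ) ≤ somborWeight (x + 1) y :=
      sqrt_le_somborWeight (by omega) (by push_cast; linarith)
    have hab : somborWeight x y ^ 2 - somborWeight (x + 1) y ^ 2 ≤ 1 := by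
      rw [somborWeight_sq h, somborWeight_sq (by omega), tsub_le_iff_right]
      push_cast
      have h1 : (0 : ℝ) < x + y - 2 := by linarith
      have h2 : (0 : ℝ) < x + 1 + y - 2 := by linarith
      rw [← sub_nonneg]
      have : (0 : ℝ) ≤ 2 * x * (x - 3) + 2 * y * (2 * x - 1) := by
        nlinarith [mul_nonneg (sub_nonneg.2 hX) (sub_nonneg.2 hXY), sq_nonneg ((x : ℝ) - 1),
          mul_nonneg (sub_nonneg.2 hX) (sub_nonneg.2 hXY')]
      have key : 1 + (((x : ℝ) + 1) ^ 2 + (y : ℝ) ^ 2) / (x + 1 + y - 2)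
          - ((x : ℝ) ^ 2 + (y : ℝ) ^ 2) / (x + y - 2)
          = (2 * x * (x - 3) + 2 * y * (2 * x - 1)) / ((x + 1 + y - 2) * (x + y - 2)) := by
        field_simp
        ring
      rw [key]
      positivity
    rcases le_or_gt (somborWeight x y) (somborWeight (x + 1) y) with hle | hlt
    · linarith
    · rw [le_div_iff₀ (by positivity)]
      nlinarith

/-- The left side is the total loss caused by a new edge between vertices of degrees `x` and `y`;
the right side is what that edge brings. -/
theorem half_sqrt_add_half_sqrt_lt_somborWeight {x y : ℕ} (h : 1 ≤ x + y) :
    √x / 2 + √y / 2 < somborWeight (x + 1) (y + 1) := by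
  have hXY : (1 : ℝ) ≤ x + y := mod_cast h
  refine Real.lt_sqrt_of_sq_lt ?_
  have h1 := Real.sq_sqrt (Nat.cast_nonneg (α := ℝ) x)
  have h2 := Real.sq_sqrt (Nat.cast_nonneg (α := ℝ) y)
  have : (√x / 2 + √y / 2) ^ 2 ≤ ((x : ℝ) + y) / 2 := by
    nlinarith [sq_nonneg (√(x : ℝ) - √y)]
  refine this.trans_lt ?_
  push_cast
  rw [lt_div_iff₀ (by linarith)]
  nlinarith [sq_nonneg ((x : ℝ) - y)]

/-- If both degrees lie between `2` and `m`, the weight is at most `√(m + 2)`. -/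
theorem somborWeight_le_sqrt {x y m : ℕ} (hx : 2 ≤ x) (hy : 2 ≤ y) (hxm : x ≤ m) (hym : y ≤ m) :
    somborWeight x y ≤ √((m : ℝ) + 2) := by
  wlog hxy : x ≤ y generalizing x y
  · rw [somborWeight_comm]
    exact this hy hx hym hxm (by omega)
  have hX : (2 : ℝ) ≤ x := mod_cast hx
  have hXY : (x : ℝ) ≤ y := mod_cast hxy
  have hYM : (y : ℝ) ≤ m := mod_cast hym
  refine Real.sqrt_le_sqrt ?_
  rw [div_le_iff₀ (by linarith)]
  nlinarith [mul_nonneg (sub_nonneg.2 hYM) (by linarith : (0 : ℝ) ≤ x + y - 2),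
    mul_nonneg (sub_nonneg.2 hX) (sub_nonneg.2 hXY)]

/-! ### Edge sums and strict monotonicity of the index -/

namespace SimpleGraph

variable {V W : Type*}

/-- A sum over the edges, taken twice, is a sum over the ordered pairs of adjacent vertices. -/
theorem two_mul_sum_edgeFinset [Fintype V] [DecidableEq V] (G : SimpleGraph V)
    [DecidableRel G.Adj] (F : Sym2 V → ℝ) :
    2 * ∑ e ∈ G.edgeFinset, F e = ∑ x, ∑ y, if G.Adj x y then F s(x, y) else 0 := by
  have h1 : ∑ d : G.Dart, F d.edge = 2 * ∑ e ∈ G.edgeFinset, F e := by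
    rw [← sum_fiberwise_of_maps_to (g := Dart.edge) (t := G.edgeFinset)
      (fun d _ => by simp), mul_sum]
    refine sum_congr rfl fun e he => ?_
    rw [sum_congr rfl (g := fun _ => F e) (fun d hd => by rw [(mem_filter.1 hd).2]), sum_const,
      G.dart_edge_fiber_card e (by simpa using he)]
    simp
  rw [← h1, ← Fintype.sum_prod_type' (f := fun x y => if G.Adj x y then F s(x, y) else 0),
    ← sum_filter]
  refine sum_bij' (fun d _ => d.toProd) (fun p hp => ⟨p, (mem_filter.1 hp).2⟩) ?_ ?_ ?_ ?_ ?_ <;>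
    simp +contextual [Dart.edge]

theorem augmentedSombor_eq_sum [Fintype V] [DecidableEq V] (G : SimpleGraph V) [DecidableRel G.Adj] :
    2 * G.augmentedSombor =
      ∑ x, ∑ y, if G.Adj x y then somborWeight (G.degree x) (G.degree y) else 0 := by
  rw [augmentedSombor, two_mul_sum_edgeFinset]
  rfl

theorem Iso.augmentedSombor_eq [Fintype V] [DecidableEq V] [Fintype W] [DecidableEq W]
    {G : SimpleGraph V} {H : SimpleGraph W} [DecidableRel G.Adj]
    [DecidableRel H.Adj] (f : G ≃g H) : G.augmentedSombor = H.augmentedSombor := by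
  have : 2 * G.augmentedSombor = 2 * H.augmentedSombor := by
    rw [augmentedSombor_eq_sum, augmentedSombor_eq_sum, ← f.toEquiv.sum_comp]
    refine sum_congr rfl fun x _ => ?_
    rw [← f.toEquiv.sum_comp]
    refine sum_congr rfl fun y _ => ?_
    simp [f.map_adj_iff]
  linarith

theorem Connected.exists_adj_of_mem_of_notMem {G : SimpleGraph V} (hG : G.Connected) {A : Set V}
    {u w : V} (hu : u ∈ A) (hw : w ∉ A) : ∃ x ∈ A, ∃ y ∉ A, G.Adj x y := by
  obtain ⟨p⟩ := hG.preconnected u w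
  obtain ⟨d, -, h1, h2⟩ := p.exists_boundary_dart A hu hw
  exact ⟨_, h1, _, h2, d.adj⟩

theorem Connected.one_le_degree [Fintype V] {G : SimpleGraph V} [DecidableRel G.Adj] (hG : G.Connected)
    (h2 : 2 ≤ Fintype.card V) (v : V) : 1 ≤ G.degree v := by
  have : Nontrivial V := Fintype.one_lt_card_iff_nontrivial.1 h2
  exact hG.preconnected.degree_pos_of_nontrivial v

/-- Otherwise both ends have degree 1, and no edge leaves `{x, y}` towards a third vertex. This
keeps the denominators of the weights positive. -/
theorem Connected.three_le_degree_add_degree [Fintype V] {G : SimpleGraph V} [DecidableRel G.Adj]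
    (hG : G.Connected) (h3 : 3 ≤ Fintype.card V) {x y : V} (hxy : G.Adj x y) :
    3 ≤ G.degree x + G.degree y := by
  classical
  by_contra! hlt
  have hx := hG.one_le_degree (by omega) x
  have hy := hG.one_le_degree (by omega) y
  obtain ⟨w, hw⟩ : ∃ w, w ∉ ({x, y} : Finset V) := by
    by_contra! h
    have := card_le_card (fun w _ => h w : (univ : Finset V) ⊆ {x, y})
    have := card_le_two (a := x) (b := y)
    simp only [card_univ] at *
    omega
  obtain ⟨a, ha, b, hb, hab⟩ := hG.exists_adj_of_mem_of_notMem (A := {x, y}) (u := x) (w := w)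
    (by simp) (by simpa using hw)
  have key : ∀ {p q : V}, G.Adj p q → G.degree p ≤ 1 → ∀ c, G.Adj p c → c = q := by
    intro p q hpq hp c hc
    exact card_le_one.1 hp c (by simpa using hc) q (by simpa using hpq)
  simp only [Set.mem_insert_iff, Set.mem_singleton_iff] at ha hb
  rcases ha with rfl | rfl
  · exact hb (Or.inr (key hxy (by omega) b hab))
  · exact hb (Or.inl (key hxy.symm (by omega) b hab))

theorem degree_sup_edge [Fintype V] [DecidableEq V]
    {G : SimpleGraph V} [DecidableRel G.Adj] {u v : V} (huv : u ≠ v)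
    (hn : ¬ G.Adj u v) [DecidableRel (G ⊔ edge u v).Adj] (x : V) :
    (G ⊔ edge u v).degree x = G.degree x + if x = u ∨ x = v then 1 else 0 := by
  have hn' : ¬ G.Adj v u := fun h => hn h.symm
  simp only [← card_neighborFinset_eq_degree]
  split_ifs with h
  · rcases h with rfl | rfl
    · rw [← card_insert_of_notMem (a := v) (s := G.neighborFinset x) (by simpa using hn)]
      congr 1
      ext w
      simp only [mem_neighborFinset, sup_adj, edge_adj, mem_insert]
      grind
    · rw [← card_insert_of_notMem (a := u) (s := G.neighborFinset x) (by simpa using hn')]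
      congr 1
      ext w
      simp only [mem_neighborFinset, sup_adj, edge_adj, mem_insert]
      grind
  · congr 1
    ext w
    simp only [mem_neighborFinset, sup_adj, edge_adj]
    grind

theorem sum_adj_add_eq_two_mul_sum_degree_mul [Fintype V] (G : SimpleGraph V) [DecidableRel G.Adj]
    (φ : V → ℝ) :
    (∑ x, ∑ y, if G.Adj x y then φ x + φ y else 0) = 2 * ∑ x, G.degree x * φ x := by
  have h1 : (∑ x, ∑ y, if G.Adj x y then φ x else 0) = ∑ x, G.degree x * φ x := by
    refine sum_congr rfl fun x _ => ?_
    rw [← sum_filter, sum_const, ← G.neighborFinset_eq_filter, card_neighborFinset_eq_degree,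
      nsmul_eq_mul]
  have h2 : (∑ x, ∑ y, if G.Adj x y then φ y else 0) = ∑ x, G.degree x * φ x := by
    rw [sum_comm, ← h1]
    simp only [G.adj_comm]
  have h3 : ∀ x y, (if G.Adj x y then φ x + φ y else 0)
      = (if G.Adj x y then φ x else 0) + if G.Adj x y then φ y else 0 := by
    intro x y; split_ifs <;> simp
  simp only [h3, sum_add_distrib, h1, h2]
  ring

/-- Adding an edge to a connected graph raises the augmented Sombor index. -/
theorem Connected.augmentedSombor_lt_sup_edge [Fintype V] [DecidableEq V]
    {G : SimpleGraph V} [DecidableRel G.Adj]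
    (hG : G.Connected) (h3 : 3 ≤ Fintype.card V) {u v : V} (huv : u ≠ v) (hn : ¬ G.Adj u v)
    {H : SimpleGraph V} [DecidableRel H.Adj] (hH : H = G ⊔ edge u v) :
    G.augmentedSombor < H.augmentedSombor := by
  have hdeg : ∀ x, H.degree x = G.degree x + if x = u ∨ x = v then 1 else 0 := by
    subst hH
    exact degree_sup_edge huv hn
  have hE : H.edgeFinset = insert s(u, v) G.edgeFinset := by
    subst hH
    ext e
    simp [edgeSet_edge_of_ne huv, or_comm]
  let F : Sym2 V → ℝ := Sym2.lift
    ⟨fun x y => somborWeight (H.degree x) (H.degree y), fun x y => somborWeight_comm _ _⟩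
  have hHs : H.augmentedSombor =
      somborWeight (G.degree u + 1) (G.degree v + 1) + ∑ e ∈ G.edgeFinset, F e := by
    have : H.augmentedSombor = ∑ e ∈ H.edgeFinset, F e := rfl
    rw [this, hE, sum_insert (by simpa using hn)]
    congr 1
    change somborWeight (H.degree u) (H.degree v) = _
    simp [hdeg]
  -- The charge at a vertex bounds the loss of each edge there. Since `uv` is not an edge of `G`, at
  -- most one end of any edge of `G` changes degree.
  let φ : V → ℝ := fun x => if x = u ∨ x = v then 1 / (2 * √(G.degree x)) else 0
  have hterm : ∀ x y, G.Adj x y → somborWeight (G.degree x) (G.degree y) ≤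
      somborWeight (H.degree x) (H.degree y) + (φ x + φ y) := by
    intro x y hxy
    have hx := hG.one_le_degree (by omega) x
    have hy := hG.one_le_degree (by omega) y
    have h := hG.three_le_degree_add_degree h3 hxy
    by_cases h1 : x = u ∨ x = v
    · have h2 : ¬ (y = u ∨ y = v) := by
        rcases h1 with rfl | rfl <;> rintro (rfl | rfl) <;>
          first | exact G.irrefl hxy | exact hn hxy | exact hn hxy.symm
      have := somborWeight_sub_le hx hy h
      simp only [hdeg, φ, h1, h2, if_true, if_false, add_zero]
      linarith
    · by_cases h2 : y = u ∨ y = v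
      · have := somborWeight_sub_le hy hx (by omega)
        simp only [hdeg, φ, h1, h2, if_true, if_false, add_zero, zero_add]
        rw [somborWeight_comm (G.degree x), somborWeight_comm (G.degree x)]
        linarith
      · simp [hdeg, φ, h1, h2]
  have hsum : 2 * G.augmentedSombor ≤
      2 * ∑ e ∈ G.edgeFinset, F e + 2 * ∑ x, G.degree x * φ x := by
    rw [augmentedSombor_eq_sum, two_mul_sum_edgeFinset, ← sum_adj_add_eq_two_mul_sum_degree_mul,
      ← sum_add_distrib]
    refine sum_le_sum fun x _ => ?_
    rw [← sum_add_distrib]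
    refine sum_le_sum fun y _ => ?_
    split_ifs with hxy
    · exact hterm x y hxy
    · simp
  have hφsum : ∑ x, G.degree x * φ x = √(G.degree u) / 2 + √(G.degree v) / 2 := by
    have hval : ∀ d : ℕ, 1 ≤ d → (d : ℝ) * (1 / (2 * √d)) = √d / 2 := by
      intro d hd
      have hd' : (0 : ℝ) < d := mod_cast hd
      have := Real.sqrt_pos.2 hd'
      have h2 := Real.mul_self_sqrt hd'.le
      field_simp
      nlinarith
    rw [← sum_subset (subset_univ {u, v}) (fun x _ hx => by
      have : ¬ (x = u ∨ x = v) := by simpa using hx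
      simp [φ, this]), sum_pair huv]
    simp only [φ, true_or, or_true, if_true]
    rw [hval _ (hG.one_le_degree (by omega) u), hval _ (hG.one_le_degree (by omega) v)]
  have := half_sqrt_add_half_sqrt_lt_somborWeight (x := G.degree u) (y := G.degree v)
    (by have := hG.one_le_degree (by omega) u; omega)
  rw [hφsum] at hsum
  rw [hHs]
  linarith

/-- The augmented Sombor index is strictly monotone on connected graphs. -/
theorem Connected.augmentedSombor_lt_of_lt [Fintype V] [DecidableEq V]
    {G H : SimpleGraph V} [DecidableRel G.Adj]
    [DecidableRel H.Adj] (hG : G.Connected) (h3 : 3 ≤ Fintype.card V) (hGH : G < H) :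
    G.augmentedSombor < H.augmentedSombor := by
  classical
  revert hG
  -- Induction on the number of edges of `H` missing from `G`.
  induction hm : #(H.edgeFinset \ G.edgeFinset) using Nat.strong_induction_on generalizing G with
  | _ m ih =>
    intro hG
    obtain ⟨u, v, hH, hn⟩ : ∃ u v, H.Adj u v ∧ ¬ G.Adj u v := by
      by_contra! h
      exact hGH.not_ge fun u v => h u v
    have hlt := hG.augmentedSombor_lt_sup_edge h3 hH.ne hn rfl
    have hle : G ⊔ edge u v ≤ H := sup_le hGH.le (by
      intro a b hab
      rw [edge_adj] at hab
      rcases hab.1 with ⟨rfl, rfl⟩ | ⟨rfl, rfl⟩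
      · exact hH
      · exact hH.symm)
    rcases hle.eq_or_lt with heq | hlt'
    · exact hG.augmentedSombor_lt_sup_edge h3 hH.ne hn heq.symm
    · refine hlt.trans (ih _ ?_ hlt' rfl (hG.mono le_sup_left))
      rw [← hm]
      refine card_lt_card ⟨fun e he => ?_, fun hsub => ?_⟩
      · simp only [mem_sdiff, mem_edgeFinset] at he ⊢
        exact ⟨he.1, fun h => he.2 (edgeSet_mono le_sup_left h)⟩
      · have : s(u, v) ∈ H.edgeFinset \ G.edgeFinset := by simp [hH, hn]
        have := hsub this
        simp [hH.ne] at this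

end SimpleGraph

/-! ### The extremal graph: its index and its recognition -/

namespace SimpleGraph

theorem degree_eq_sum {V : Type*} [Fintype V] (G : SimpleGraph V) [DecidableRel G.Adj] (x : V) :
    G.degree x = ∑ y, if G.Adj x y then 1 else 0 := by
  rw [← card_filter, ← G.neighborFinset_eq_filter, card_neighborFinset_eq_degree]

end SimpleGraph

section extremalGraph

variable {n k : ℕ}

@[simp] theorem extremalGraph_adj_inl_inl (x y : Fin 1 ⊕ Fin (n - k - 1)) :
    (extremalGraph n k).Adj (.inl x) (.inl y) ↔
      ((SimpleGraph.completeGraph (Fin 1)) ⊕g (SimpleGraph.completeGraph (Fin (n - k - 1)))).Adj x y := by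
  simp [extremalGraph, SimpleGraph.join]

@[simp] theorem extremalGraph_adj_inl_inr (x : Fin 1 ⊕ Fin (n - k - 1)) (y : Fin k) :
    (extremalGraph n k).Adj (.inl x) (.inr y) := by
  simp [extremalGraph, SimpleGraph.join]

@[simp] theorem extremalGraph_adj_inr_inl (y : Fin k) (x : Fin 1 ⊕ Fin (n - k - 1)) :
    (extremalGraph n k).Adj (.inr y) (.inl x) := by
  simp [extremalGraph, SimpleGraph.join]

@[simp] theorem extremalGraph_adj_inr_inr (x y : Fin k) :
    (extremalGraph n k).Adj (.inr x) (.inr y) ↔ x ≠ y := by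
  simp [extremalGraph, SimpleGraph.join]

theorem Fin.sum_ite_ne {M : Type*} [AddCommMonoid M] (m : ℕ) (c : M) (i : Fin m) :
    (∑ j, if i ≠ j then c else 0) = (m - 1) • c := by
  rw [← sum_filter, filter_ne, Finset.sum_const, card_erase_of_mem (mem_univ i), card_univ,
    Fintype.card_fin]

theorem extremalGraph_degree_inl_inl [DecidableRel (extremalGraph n k).Adj]
    (x : Fin 1) :
    (extremalGraph n k).degree (.inl (.inl x)) = k := by
  simp [SimpleGraph.degree_eq_sum, Fintype.sum_sum_type, -sum_boole, Subsingleton.elim _ x]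

theorem extremalGraph_degree_inl_inr [DecidableRel (extremalGraph n k).Adj]
    (h : k + 1 ≤ n) (x : Fin (n - k - 1)) :
    (extremalGraph n k).degree (.inl (.inr x)) = n - 2 := by
  have := x.2
  have := Fin.sum_ite_ne _ 1 x
  simp [SimpleGraph.degree_eq_sum, Fintype.sum_sum_type, -sum_boole] at this ⊢
  omega

theorem extremalGraph_degree_inr [DecidableRel (extremalGraph n k).Adj]
    (h : k + 1 ≤ n) (x : Fin k) :
    (extremalGraph n k).degree (.inr x) = n - 1 := by
  have := x.2
  have := Fin.sum_ite_ne _ 1 x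
  simp [SimpleGraph.degree_eq_sum, Fintype.sum_sum_type, -sum_boole] at this ⊢
  omega

theorem augmentedSombor_extremalGraph [DecidableRel (extremalGraph n k).Adj]
    (hn : 4 ≤ n) (h : k + 1 ≤ n) :
    (extremalGraph n k).augmentedSombor = asoBound n k := by
  have hn' : (4 : ℝ) ≤ n := mod_cast hn
  have h1 : ((n - 1 : ℕ) : ℝ) = n - 1 := by push_cast [(by omega : 1 ≤ n)]; ring
  have h2 : ((n - 2 : ℕ) : ℝ) = n - 2 := by push_cast [(by omega : 2 ≤ n)]; ring
  have hm : ((n - k - 1 : ℕ) : ℝ) = n - k - 1 := by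
    push_cast [(by omega : 1 ≤ n - k), (by omega : k ≤ n)]; ring
  -- The four radicals of the bound are the weights of the four kinds of edges, by the degrees `k`,
  -- `n - 2`, `n - 1` of their ends.
  have e1 : √((((n : ℝ) - 1) ^ 2 + (k : ℝ) ^ 2) / ((n : ℝ) + k - 3)) = somborWeight k (n - 1) := by
    rw [somborWeight, h1]; congr 2 <;> ring
  have e2 : √((n : ℝ) + 1 / ((n : ℝ) - 2)) = somborWeight (n - 1) (n - 1) := by
    rw [somborWeight, h1]
    have a : (n : ℝ) - 2 ≠ 0 := by linarith
    have b : (n : ℝ) - 1 + (n - 1) - 2 ≠ 0 := by linarith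
    congr 1; rw [eq_div_iff b]; field_simp; ring
  have e3 : √((n : ℝ) - 1 / 2 + 5 / (2 * (2 * (n : ℝ) - 5))) = somborWeight (n - 2) (n - 1) := by
    rw [somborWeight, h1, h2]
    have a : 2 * (n : ℝ) - 5 ≠ 0 := by linarith
    rw [(by ring : (n : ℝ) - 2 + (n - 1) - 2 = 2 * n - 5)]
    congr 1
    rw [eq_div_iff a, add_mul, div_mul_eq_mul_div, mul_div_mul_right _ _ a]
    ring
  have e4 : √((n : ℝ) - 1 + 1 / ((n : ℝ) - 3)) = somborWeight (n - 2) (n - 2) := by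
    rw [somborWeight, h2]
    have a : (n : ℝ) - 3 ≠ 0 := by linarith
    have b : (n : ℝ) - 2 + (n - 2) - 2 ≠ 0 := by linarith
    congr 1; rw [eq_div_iff b]; field_simp; ring
  have hch : ∀ p : ℕ, (p : ℝ) * ((p - 1 : ℕ) : ℝ) = 2 * (p.choose 2 : ℝ) := by
    intro p
    rw [Nat.cast_choose_two]
    rcases p with _ | p <;> simp
    ring
  have key := (extremalGraph n k).augmentedSombor_eq_sum
  have s1 := fun (c : ℝ) x => Fin.sum_ite_ne (n - k - 1) c x
  have s2 := fun (c : ℝ) x => Fin.sum_ite_ne k c x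
  simp only [Fintype.sum_sum_type, extremalGraph_degree_inl_inl, extremalGraph_degree_inl_inr h,
    extremalGraph_degree_inr h, extremalGraph_adj_inl_inl, extremalGraph_adj_inl_inr,
    extremalGraph_adj_inr_inl, extremalGraph_adj_inr_inr, SimpleGraph.sum_adj, s2, if_true,
    SimpleGraph.top_adj, SimpleGraph.completeGraph, s1, sum_const, card_univ, Fintype.card_fin, ne_eq,
    Subsingleton.elim _ (0 : Fin 1), not_true, if_false, nsmul_eq_mul] at key
  simp at key
  rw [asoBound, e1, e2, e3, e4, ← hm]
  have c1 := hch k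
  have c2 := hch (n - k - 1)
  rw [somborWeight_comm (n - 1) k, somborWeight_comm (n - 1) (n - 2)] at key
  linear_combination key / 2 + somborWeight (n - 1) (n - 1) / 2 * c1
    + somborWeight (n - 2) (n - 2) / 2 * c2

/-- A complete graph in which one vertex has lost all but `k` of its edges. -/
theorem nonempty_iso_extremalGraph {V : Type*} [Fintype V] [DecidableEq V] {G H : SimpleGraph V}
    [DecidableRel G.Adj] (hn : Fintype.card V = n) {v : V} (hv : G.degree v = k)
    (hH : ∀ x y, H.Adj x y ↔ x ≠ y ∧ (x = v → G.Adj v y) ∧ (y = v → G.Adj v x)) :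
    Nonempty (H ≃g extremalGraph n k) := by
  have hK : Fintype.card {x // G.Adj v x} = k := by
    rw [Fintype.card_subtype, ← G.neighborFinset_eq_filter, G.card_neighborFinset_eq_degree, hv]
  have hM : Fintype.card {x // x ≠ v ∧ ¬ G.Adj v x} = n - k - 1 := by
    have hset : ({x | x ≠ v ∧ ¬ G.Adj v x} : Finset V) = (insert v (G.neighborFinset v))ᶜ := by
      ext x; simp
    rw [Fintype.card_subtype, hset, card_compl, card_insert_of_notMem (by simp),
      G.card_neighborFinset_eq_degree, hv, hn]
    omega
  have eK : Fin k ≃ {x // G.Adj v x} := (Fintype.equivFinOfCardEq hK).symm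
  have eM : Fin (n - k - 1) ≃ {x // x ≠ v ∧ ¬ G.Adj v x} := (Fintype.equivFinOfCardEq hM).symm
  let g : (Fin 1 ⊕ Fin (n - k - 1)) ⊕ Fin k → V :=
    Sum.elim (Sum.elim (fun _ => v) (fun i => eM i)) (fun j => eK j)
  have hMp := fun i => (eM i).2
  have hKp := fun j => (eK j).2
  have hne := fun j => (hKp j).ne'
  have hMinj : ∀ i j, (eM i : V) = eM j ↔ i = j := fun i j => by
    rw [Subtype.coe_inj, eM.apply_eq_iff_eq]
  have hKinj : ∀ i j, (eK i : V) = eK j ↔ i = j := fun i j => by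
    rw [Subtype.coe_inj, eK.apply_eq_iff_eq]
  have hg : Function.Bijective g := by
    constructor
    · rintro ((x | x) | x) ((y | y) | y) hxy <;> simp only [g, Sum.elim_inl, Sum.elim_inr] at hxy <;>
        first | rw [Subsingleton.elim x y] | grind
    · intro x
      by_cases h1 : x = v
      · exact ⟨.inl (.inl 0), h1.symm⟩
      · by_cases h2 : G.Adj v x
        · exact ⟨.inr (eK.symm ⟨x, h2⟩), by simp [g]⟩
        · exact ⟨.inl (.inr (eM.symm ⟨x, h1, h2⟩)), by simp [g]⟩
  refine ⟨SimpleGraph.Iso.symm ⟨Equiv.ofBijective g hg, ?_⟩⟩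
  rintro ((x | x) | x) ((y | y) | y) <;>
    simp [g, hH, hMinj, hKinj, SimpleGraph.completeGraph] <;> grind

end extremalGraph

/-! ### Edge cuts, and graphs whose degrees all exceed the edge connectivity -/

namespace SimpleGraph

variable {V : Type*} [Fintype V] [DecidableEq V] {G : SimpleGraph V} [DecidableRel G.Adj]

theorem exists_finset_card_eq_edgeConnectivity (G : SimpleGraph V) (h2 : 2 ≤ Fintype.card V) :
    ∃ s : Finset (Sym2 V), (s : Set (Sym2 V)) ⊆ G.edgeSet ∧ #s = G.edgeConnectivity ∧
      ¬ (G.deleteEdges (s : Set (Sym2 V))).Connected := by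
  classical
  -- Deleting all edges disconnects, so the infimum is attained and is not the default `sInf ∅ = 0`.
  refine Nat.sInf_mem (s := {m : ℕ | ∃ s : Finset (Sym2 V),
    (s : Set (Sym2 V)) ⊆ G.edgeSet ∧ #s = m ∧ ¬ (G.deleteEdges (s : Set (Sym2 V))).Connected})
    ⟨_, G.edgeFinset, by simp, rfl, fun h => ?_⟩
  obtain ⟨v⟩ := h.nonempty
  have := h.one_le_degree h2 v
  simp at this

theorem edgeConnectivity_le_degree (h2 : 2 ≤ Fintype.card V) (v : V) :
    G.edgeConnectivity ≤ G.degree v := by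
  classical
  refine Nat.sInf_le ⟨G.incidenceFinset v, ?_, G.card_incidenceFinset_eq_degree v, fun h => ?_⟩
  · simpa using G.incidenceSet_subset v
  · have hd := h.one_le_degree h2 v
    rw [← card_neighborFinset_eq_degree, Nat.one_le_iff_ne_zero, card_ne_zero] at hd
    obtain ⟨w, hw⟩ := hd
    simp [deleteEdges_adj, incidenceSet] at hw

/-- The edge connectivity is attained by the edges between a set of vertices and its
complement. -/
theorem exists_card_interedges_compl_le (h2 : 2 ≤ Fintype.card V) :
    ∃ A : Finset V, A.Nonempty ∧ Aᶜ.Nonempty ∧ #(G.interedges A Aᶜ) ≤ G.edgeConnectivity := by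
  classical
  obtain ⟨s, -, hcard, hs⟩ := G.exists_finset_card_eq_edgeConnectivity h2
  have : Nonempty V := Fintype.card_pos_iff.1 (by omega)
  have hpre : ¬ (G.deleteEdges (s : Set (Sym2 V))).Preconnected := fun h => hs ⟨h⟩
  simp only [Preconnected, not_forall] at hpre
  obtain ⟨u, w, huw⟩ := hpre
  -- The set is the component of `u` after deletion; every edge of `G` leaving it was deleted.
  refine ⟨univ.filter ((G.deleteEdges (s : Set (Sym2 V))).Reachable u), ⟨u, by simp⟩,
    ⟨w, by simpa using huw⟩, ?_⟩
  rw [← hcard]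
  refine card_le_card_of_injOn (fun p => s(p.1, p.2)) ?_ ?_
  · rintro ⟨x, y⟩ hxy
    simp only [mem_coe, interedges, Rel.mem_interedges_iff, mem_filter, mem_univ, true_and,
      mem_compl] at hxy
    by_contra hn
    exact hxy.2.1 (hxy.1.trans (Adj.reachable (by simpa [deleteEdges_adj] using ⟨hxy.2.2, hn⟩)))
  · rintro ⟨x, y⟩ hxy ⟨x', y'⟩ hxy' heq
    simp only [mem_coe, interedges, Rel.mem_interedges_iff, mem_filter, mem_univ, true_and,
      mem_compl] at hxy hxy'
    simp only [Sym2.eq_iff] at heq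
    rcases heq with ⟨rfl, rfl⟩ | ⟨rfl, rfl⟩
    · rfl
    · exact absurd hxy.1 hxy'.2.1

theorem degree_add_one_le_card_add_card_interedges_singleton {A : Finset V} {u : V} (hu : u ∈ A) :
    G.degree u + 1 ≤ #A + #(G.interedges {u} Aᶜ) := by
  have h1 : G.neighborFinset u ⊆ A.erase u ∪ (G.interedges {u} Aᶜ).image Prod.snd := by
    intro w hw
    rw [mem_neighborFinset] at hw
    by_cases hA : w ∈ A
    · exact mem_union_left _ (mem_erase.2 ⟨hw.ne', hA⟩)
    · exact mem_union_right _ (mem_image.2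
        ⟨(u, w), by simp [interedges, Rel.mem_interedges_iff, hA, hw], rfl⟩)
  have h2 := (card_le_card h1).trans ((card_union_le _ _).trans
    (Nat.add_le_add_left card_image_le _))
  rw [card_neighborFinset_eq_degree, card_erase_of_mem hu] at h2
  have := card_pos.2 ⟨u, hu⟩
  omega

/-- Each vertex of `A` has at most `#A - 1` neighbours in `A`; the remaining incidences are cut
edges. -/
theorem sum_degree_add_card_le (A : Finset V) :
    ∑ u ∈ A, G.degree u + #A ≤ #A * #A + #(G.interedges A Aᶜ) := by
  have h1 : #(G.interedges A Aᶜ) = ∑ u ∈ A, #(G.interedges {u} Aᶜ) := by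
    have h := G.interedges_biUnion_left A Aᶜ singleton
    rw [A.biUnion_singleton_eq_self] at h
    rw [h, card_biUnion]
    exact fun x _ y _ hxy => G.interedges_disjoint_left (by simpa using hxy) _
  rw [h1, card_eq_sum_ones A, ← sum_add_distrib, sum_mul, ← card_eq_sum_ones, ← sum_add_distrib]
  exact sum_le_sum fun u hu => by simpa using degree_add_one_le_card_add_card_interedges_singleton hu

theorem degree_add_one_le_card_add_card_interedges_compl {A : Finset V} {u : V} (hu : u ∈ A) :
    G.degree u + 1 ≤ #A + #(G.interedges A Aᶜ) :=
  (degree_add_one_le_card_add_card_interedges_singleton hu).trans (Nat.add_le_add_left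
    (card_le_card (Rel.interedges_mono (by simpa using hu) subset_rfl)) _)

/-- A side of a cut with at most `k` edges is large when all degrees exceed `k`. -/
theorem add_two_le_card_of_interedges_compl {k : ℕ} (hdeg : ∀ v, k + 1 ≤ G.degree v) {A : Finset V}
    (hA : A.Nonempty) (hk : #(G.interedges A Aᶜ) ≤ k) : k + 2 ≤ #A := by
  have h1 := G.sum_degree_add_card_le A
  have h2 : #A * (k + 1) ≤ ∑ u ∈ A, G.degree u := by
    rw [← smul_eq_mul]
    exact card_nsmul_le_sum _ _ _ fun v _ => hdeg v
  have := hA.card_pos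
  -- With `a = #A`, the bounds give `a(k + 2 - a) ≤ k`, but the left side is at least `k + 1` for `1
  -- ≤ a ≤ k + 1`.
  by_contra! h
  nlinarith

/-- If all degrees exceed the edge connectivity then the index is below the bound. -/
theorem augmentedSombor_lt_of_edgeConnectivity_lt_degree {n : ℕ} (hn : Fintype.card V = n)
    (hn4 : 4 ≤ n) (hk : 1 ≤ G.edgeConnectivity) (hdeg : ∀ v, G.edgeConnectivity + 1 ≤ G.degree v) :
    G.augmentedSombor < asoBound n G.edgeConnectivity := by
  obtain ⟨A, hA, hB, hcut⟩ := G.exists_card_interedges_compl_le (by omega)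
  set k := G.edgeConnectivity
  have hcut' : #(G.interedges Aᶜ Aᶜᶜ) ≤ k := by
    rw [compl_compl]
    have : Std.Symm G.Adj := G.symm
    exact (Rel.card_interedges_comm _ _).trans_le hcut
  have ha := add_two_le_card_of_interedges_compl hdeg hA hcut
  have hb := add_two_le_card_of_interedges_compl hdeg hB hcut'
  have hab : #A + #Aᶜ = n := by rw [card_add_card_compl, hn]
  -- The other side has at least `k + 2` vertices, so a degree is at most `(n - k - 2) + k - 1`.
  have hmax : ∀ v, G.degree v ≤ n - 3 := by
    intro v
    by_cases hv : v ∈ A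
    · have := degree_add_one_le_card_add_card_interedges_compl (G := G) hv
      omega
    · have := degree_add_one_le_card_add_card_interedges_compl (G := G) (mem_compl.2 hv)
      omega
  have hn3 : ((n - 3 : ℕ) : ℝ) + 2 = n - 1 := by
    push_cast [(by omega : 3 ≤ n)]; ring
  have hw : G.augmentedSombor ≤ #G.edgeFinset * √((n : ℝ) - 1) := by
    rw [augmentedSombor, ← nsmul_eq_mul]
    refine sum_le_card_nsmul _ _ _ fun e _ => ?_
    induction e using Sym2.ind with
    | _ x y =>
      rw [← hn3]
      exact somborWeight_le_sqrt (by linarith [hdeg x]) (by linarith [hdeg y]) (hmax x) (hmax y)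
  have hcount : 2 * #G.edgeFinset < (n - 1) * (n - 2) := by
    have hs : ∑ u ∈ A, G.degree u + ∑ u ∈ Aᶜ, G.degree u = 2 * #G.edgeFinset := by
      rw [sum_add_sum_compl, sum_degrees_eq_twice_card_edges]
    have h1 := G.sum_degree_add_card_le A
    have h2 := G.sum_degree_add_card_le Aᶜ
    obtain ⟨p, hp⟩ := Nat.exists_eq_add_of_le ha
    obtain ⟨q, hq⟩ := Nat.exists_eq_add_of_le hb
    obtain rfl : n = 2 * k + 4 + p + q := by omega
    rw [(by omega : 2 * k + 4 + p + q - 1 = 2 * k + 3 + p + q),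
      (by omega : 2 * k + 4 + p + q - 2 = 2 * k + 2 + p + q)]
    rw [hp] at h1
    rw [hq] at h2
    nlinarith
  have hn' : (4 : ℝ) ≤ n := mod_cast hn4
  have hkn : (k : ℝ) + 1 ≤ n := mod_cast (by omega : k + 1 ≤ n)
  have hs0 : 0 < √((n : ℝ) - 1) := Real.sqrt_pos.2 (by linarith)
  have hbound : ((n : ℝ) - 1) * (n - 2) / 2 * √((n : ℝ) - 1) ≤ asoBound n k := by
    have e2 : √((n : ℝ) - 1) ≤ √((n : ℝ) + 1 / ((n : ℝ) - 2)) := by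
      have : 0 ≤ 1 / ((n : ℝ) - 2) := one_div_nonneg.2 (by linarith)
      exact Real.sqrt_le_sqrt (by linarith)
    have e3 : √((n : ℝ) - 1) ≤ √((n : ℝ) - 1 / 2 + 5 / (2 * (2 * (n : ℝ) - 5))) := by
      have : 0 ≤ 5 / (2 * (2 * (n : ℝ) - 5)) := div_nonneg (by norm_num) (by linarith)
      exact Real.sqrt_le_sqrt (by linarith)
    have e4 : √((n : ℝ) - 1) ≤ √((n : ℝ) - 1 + 1 / ((n : ℝ) - 3)) := by
      have : 0 ≤ 1 / ((n : ℝ) - 3) := one_div_nonneg.2 (by linarith)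
      exact Real.sqrt_le_sqrt (by linarith)
    have hm : ((n - k - 1 : ℕ) : ℝ) = n - k - 1 := by
      push_cast [(by omega : 1 ≤ n - k), (by omega : k ≤ n)]; ring
    -- The three coefficients count the edges of a complete graph on `n - 1` vertices; the term of
    -- the degree-`k` vertex is simply dropped.
    have hsplit : ((n : ℝ) - 1) * (n - 2) / 2 * √((n : ℝ) - 1) =
        k.choose 2 * √((n : ℝ) - 1) + k * ((n : ℝ) - k - 1) * √((n : ℝ) - 1)
          + (n - k - 1).choose 2 * √((n : ℝ) - 1) := by
      rw [Nat.cast_choose_two, Nat.cast_choose_two, hm]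
      ring
    rw [hsplit, asoBound]
    have c2 := mul_le_mul_of_nonneg_left e2 (Nat.cast_nonneg (α := ℝ) (k.choose 2))
    have c3 := mul_le_mul_of_nonneg_left e3
      (mul_nonneg (Nat.cast_nonneg (α := ℝ) k) (by linarith : 0 ≤ (n : ℝ) - k - 1))
    have c4 := mul_le_mul_of_nonneg_left e4 (Nat.cast_nonneg (α := ℝ) ((n - k - 1).choose 2))
    have c1 : 0 ≤ (k : ℝ) * √((((n : ℝ) - 1) ^ 2 + (k : ℝ) ^ 2) / ((n : ℝ) + k - 3)) := by
      positivity
    linarith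
  refine hw.trans_lt (lt_of_lt_of_le (mul_lt_mul_of_pos_right ?_ hs0) hbound)
  have h1 : ((n - 1 : ℕ) : ℝ) = n - 1 := by push_cast [(by omega : 1 ≤ n)]; ring
  have h2 : ((n - 2 : ℕ) : ℝ) = n - 2 := by push_cast [(by omega : 2 ≤ n)]; ring
  have : (2 : ℝ) * #G.edgeFinset < (n - 1) * (n - 2) := by
    rw [← h1, ← h2]; exact_mod_cast hcount
  linarith

theorem one_le_edgeConnectivity {G : SimpleGraph V} (hG : G.Connected) (h2 : 2 ≤ Fintype.card V) :
    1 ≤ G.edgeConnectivity := by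
  obtain ⟨s, -, hcard, hs⟩ := G.exists_finset_card_eq_edgeConnectivity h2
  by_contra! h
  obtain rfl : s = ∅ := card_eq_zero.1 (by omega)
  exact hs (by simpa using hG)

/-! ### The bound and its equality case -/

theorem augmentedSombor_le_asoBound_and_eq_iff (hG : G.Connected) {n : ℕ}
    (hn : Fintype.card V = n) (hn4 : 4 ≤ n) :
    G.augmentedSombor ≤ asoBound n G.edgeConnectivity ∧
      (G.augmentedSombor = asoBound n G.edgeConnectivity ↔
        Nonempty (G ≃g extremalGraph n G.edgeConnectivity)) := by
  classical
  have hle := G.edgeConnectivity_le_degree (by omega)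
  have hkn : G.edgeConnectivity + 1 ≤ n := by
    obtain ⟨v⟩ := hG.nonempty
    have := hle v
    have := G.degree_lt_card_verts v
    omega
  have hiso : Nonempty (G ≃g extremalGraph n G.edgeConnectivity) →
      G.augmentedSombor = asoBound n G.edgeConnectivity := fun ⟨f⟩ => by
    rw [f.augmentedSombor_eq, augmentedSombor_extremalGraph hn4 hkn]
  by_cases hmin : ∃ v, G.degree v = G.edgeConnectivity
  · obtain ⟨v, hv⟩ := hmin
    -- All edges are added except those at `v`, whose neighbourhood is kept.
    let H : SimpleGraph V :=
      { Adj := fun x y => x ≠ y ∧ (x = v → G.Adj v y) ∧ (y = v → G.Adj v x)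
        symm := ⟨fun x y h => ⟨h.1.symm, h.2.2, h.2.1⟩⟩
        loopless := ⟨fun x h => h.1 rfl⟩ }
    obtain ⟨f⟩ := nonempty_iso_extremalGraph (H := H) hn hv fun x y => Iff.rfl
    have hH : H.augmentedSombor = asoBound n G.edgeConnectivity := by
      rw [f.augmentedSombor_eq, augmentedSombor_extremalGraph hn4 hkn]
    have hGH : G ≤ H := fun x y h =>
      ⟨h.ne, fun hx => hx ▸ h, fun hy => hy ▸ h.symm⟩
    rcases hGH.eq_or_lt with heq | hlt
    · rw [← hH]
      -- The parameter is generalized so that rewriting `G` to `H` does not touch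
      -- `G.edgeConnectivity`.
      have hcast : ∀ k, H ≃g extremalGraph n k → Nonempty (G ≃g extremalGraph n k) := by
        rw [heq]
        exact fun _ g => ⟨g⟩
      have := hcast _ f
      refine ⟨((hiso this).trans hH.symm).le, fun _ => this, fun h => ?_⟩
      rw [hH]; exact hiso h
    · have := hG.augmentedSombor_lt_of_lt (by omega) hlt
      rw [hH] at this
      exact ⟨this.le, fun h => absurd h this.ne, hiso⟩
  · push Not at hmin
    have := augmentedSombor_lt_of_edgeConnectivity_lt_degree hn hn4
      (one_le_edgeConnectivity hG (by omega)) fun v => (hle v).lt_of_ne (hmin v).symm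
    exact ⟨this.le, fun h => absurd h this.ne, hiso⟩

end SimpleGraph

/-- For `k = n - 1` the extremal graph is complete. -/
theorem nonempty_extremalGraph_iso_completeGraph {n k : ℕ} (hn : 1 ≤ n) (hk : k = n - 1) :
    Nonempty (extremalGraph n k ≃g SimpleGraph.completeGraph (Fin n)) := by
  have hm : n - k - 1 = 0 := by omega
  have : IsEmpty (Fin (n - k - 1)) := by rw [hm]; infer_instance
  have e : (Fin 1 ⊕ Fin (n - k - 1)) ⊕ Fin k ≃ Fin n := Fintype.equivFinOfCardEq (by
    simp only [Fintype.card_sum, Fintype.card_fin]; omega)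
  refine ⟨⟨e, ?_⟩⟩
  rintro ((x | x) | x) ((y | y) | y) <;>
    first
    | exact isEmptyElim x
    | exact isEmptyElim y
    | simp [SimpleGraph.completeGraph, Subsingleton.elim x y]
    | simp [SimpleGraph.completeGraph]

theorem mainTheorem4 {V : Type*} [Fintype V] [DecidableEq V]
    (G : SimpleGraph V) [DecidableRel G.Adj] (hG : G.Connected)
    (n : ℕ) (hn : Fintype.card V = n) (hn4 : 4 ≤ n)
    (k' : ℕ) (hk' : G.edgeConnectivity = k') :
    G.augmentedSombor ≤ asoBound n k' ∧
    (k' ≤ n - 2 →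
      (G.augmentedSombor = asoBound n k' ↔ Nonempty (G ≃g extremalGraph n k'))) ∧
    (k' = n - 1 →
      (G.augmentedSombor = asoBound n k' ↔ Nonempty (G ≃g SimpleGraph.completeGraph (Fin n)))) := by
  obtain ⟨hle, hiff⟩ := SimpleGraph.augmentedSombor_le_asoBound_and_eq_iff hG hn hn4
  rw [hk'] at hle hiff
  refine ⟨hle, fun _ => hiff, fun hk => hiff.trans ?_⟩
  obtain ⟨f⟩ := nonempty_extremalGraph_iso_completeGraph (by omega) hk
  exact ⟨fun ⟨g⟩ => ⟨g.trans f⟩, fun ⟨g⟩ => ⟨g.trans f.symm⟩⟩
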